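/- For an integer $k\ge 1$ let $X(k)$ be the graph obtained from the $k$-spoke wheel by replacing each rim vertex by a copy of $K_{3,3}$ as follows: the rim vertex (of degree $3$) is first replaced by a triangle, each corner of which takes over one of the three edge-ends at the rim vertex; then each edge of the triangle is subdivided by a new vertex, and each new vertex is joined to the opposite corner of the triangle. Explicitly, $X(k)$ is the simple graph on $6k+1$ vertices consisting of a hub $h$ and vertices $\ell_i,m_i,r_i,a_i,b_i,c_i$ for $i\in\mathbb{Z}/k\mathbb{Z}$, in which each of $\ell_i,m_i,r_i$ is adjacent to each of $a_i,b_i,c_i$, the hub $h$ is adjacent to every $m_i$, $r_i$ is adjacent to $\ell_{i+1}$ for every $i$, and there are no other edges. (Thus for $k=1$ the wheel is a single edge with a loop at one end, and for $k=2$ it is a $3$-vertex path with a double edge added between its end-vertices.) Let $P_k(q)$ be the chromatic polynomial of $X(k)$, i.e. the unique polynomial whose value at each integer $q\ge 0$ is the number of proper $q$-colourings of $X(k)$. Then for all $k\ge 1$ \[ P_{k+3}(q) = A(q)(q-2)P_{k+2}(q) + B(q)(q-2)^2P_{k+1}(q) + C(q)(q-2)^3P_k(q), \] where \begin{align*} A(q)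 &= q^5-9q^4+37q^3-88q^2+127q-94,\\ B(q) &= 6q^7-81q^6+497q^5-1781q^4+4026q^3-5780q^2+4968q-2024,\\ C(q) &= (q-1)^2(3q^2-15q+25)(3q^5-33q^4+157q^3-399q^2+535q-299), \end{align*} and the base cases are \begin{align*} P_1(q) &= q(q-1)^2(q-2)(q^3-7q^2+19q-19),\\ P_2(q) &= q(q-1)(q-2)^2(q^9-17q^8+138q^7-692q^6+2353q^5-5630q^4\\ &\qquad +9525q^3-11086q^2+8152q-2913),\\ P_3(q) &= q(q-1)(q-2)^3(q^{14}-26q^{13}+328q^{12}-2645q^{11}+15181q^{10}-65498q^9\\ &\qquad +219032q^8-577468q^7+1209533q^6-2011958q^5+2633017q^4\\ &\qquad -2650178q^3+1957169q^2-957460q+235366). \end{align*} -/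

import Mathlib

open Polynomial

namespace SimpleGraph

/-- The number of maps `V → Fin n` that are constant along every edge in `A` is `n` to the number
of connected components of the graph `(V, A)`. -/
theorem card_constant_along_edges {V : Type*} [Finite V] (A : Set (Sym2 V)) (n : ℕ) :
    Nat.card {f : V → Fin n // ∀ e ∈ A, (e.map f).IsDiag} =
      n ^ Nat.card (SimpleGraph.fromEdgeSet A).ConnectedComponent := by
  have hadj : ∀ f : V → Fin n, (∀ e ∈ A, (e.map f).IsDiag) →
      ∀ u v, (SimpleGraph.fromEdgeSet A).Reachable u v → f u = f v := by
    intro f hf u v ⟨w⟩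
    induction w with
    | nil => rfl
    | cons h _ ih =>
      rw [← ih]
      have := hf _ ((SimpleGraph.fromEdgeSet_adj A).1 h).1
      simpa using this
  let φ : {f : V → Fin n // ∀ e ∈ A, (e.map f).IsDiag} ≃
      ((SimpleGraph.fromEdgeSet A).ConnectedComponent → Fin n) :=
    { toFun := fun f => Quot.lift f.1 (hadj f.1 f.2)
      invFun := fun g => ⟨fun v => g ((SimpleGraph.fromEdgeSet A).connectedComponentMk v), by
        intro e he
        induction e with
        | _ u v =>
          simp only [Sym2.map_mk, Sym2.mk_isDiag_iff]
          by_cases huv : u = v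
          · rw [huv]
          · exact congrArg g (SimpleGraph.ConnectedComponent.sound
              ((SimpleGraph.fromEdgeSet_adj A).2 ⟨he, huv⟩).reachable)⟩
      left_inv := fun f => rfl
      right_inv := fun g => by
        funext c
        induction c using Quot.ind
        rfl }
  rw [Nat.card_congr φ, Nat.card_fun, Nat.card_fin]

/-- For every finite graph there is exactly one polynomial whose value at every natural number `n`
is the number of proper colourings with `n` colours. -/
theorem existsUnique_chromaticPolynomial {V : Type*} [Finite V] (G : SimpleGraph V) :
    ∃! P : ℤ[X], ∀ n : ℕ, P.eval (n : ℤ) = Nat.card (G.Coloring (Fin n)) := by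
  classical
  have := Fintype.ofFinite V
  refine existsUnique_of_exists_of_unique ⟨∑ A ∈ G.edgeFinset.powerset, (-1) ^ A.card *
    X ^ Nat.card (SimpleGraph.fromEdgeSet (A : Set (Sym2 V))).ConnectedComponent, ?_⟩ ?_
  · intro n
    have hcol : Nat.card (G.Coloring (Fin n)) =
        Nat.card {f : V → Fin n // ∀ e ∈ G.edgeFinset, ¬ (e.map f).IsDiag} := by
      refine Nat.card_congr
        { toFun := fun c => ⟨c, ?_⟩
          invFun := fun f => SimpleGraph.Coloring.mk f.1 ?_
          left_inv := fun c => rfl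
          right_inv := fun f => rfl }
      · intro e he
        induction e with
        | _ u v =>
          simpa using c.valid (by simpa using he)
      · intro u v h
        simpa using f.2 s(u, v) (by simpa using h)
    have hcount : ∀ (p : (V → Fin n) → Prop) [DecidablePred p],
        ((Nat.card {f : V → Fin n // p f} : ℕ) : ℤ) = ∑ f : V → Fin n, if p f then 1 else 0 := by
      intro p _
      rw [Nat.card_eq_fintype_card, Fintype.card_subtype, Finset.sum_boole]
    rw [hcol, hcount]
    have hprod : ∀ f : V → Fin n,
        (if ∀ e ∈ G.edgeFinset, ¬ (e.map f).IsDiag then (1 : ℤ) else 0) =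
          ∑ A ∈ G.edgeFinset.powerset,
            (-1) ^ A.card * if ∀ e ∈ A, (e.map f).IsDiag then 1 else 0 := by
      intro f
      have h1 : (if ∀ e ∈ G.edgeFinset, ¬ (e.map f).IsDiag then (1 : ℤ) else 0) =
          ∏ e ∈ G.edgeFinset, (1 + -(if (e.map f).IsDiag then 1 else 0)) := by
        trans ∏ e ∈ G.edgeFinset, if ¬ (e.map f).IsDiag then (1 : ℤ) else 0
        · rw [Finset.prod_boole]
          congr
        refine Finset.prod_congr rfl fun e _ => ?_
        by_cases h : (e.map f).IsDiag <;> simp [h]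
      rw [h1, Finset.prod_one_add]
      refine Finset.sum_congr rfl fun A _ => ?_
      rw [Finset.prod_neg, Finset.prod_boole]
      congr
    simp_rw [hprod]
    rw [Finset.sum_comm, eval_finsetSum]
    refine Finset.sum_congr rfl fun A _ => ?_
    have hA : Nat.card {f : V → Fin n // ∀ e ∈ A, (e.map f).IsDiag} = _ :=
      card_constant_along_edges (A : Set (Sym2 V)) n
    rw [← Finset.mul_sum, ← hcount]
    rw [hA]
    simp
  · intro P Q hP hQ
    refine Polynomial.eq_of_infinite_eval_eq P Q ?_
    refine (Set.infinite_range_of_injective (Nat.cast_injective (R := ℤ))).mono ?_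
    rintro _ ⟨n, rfl⟩
    exact (hP n).trans (hQ n).symm

/-- The chromatic polynomial `P_G` of a finite graph `G`: the unique polynomial such that
`P_G(n)` is the number of proper colourings of `G` with `n` colours, for every `n : ℕ`. -/
noncomputable def chromaticPolynomial {V : Type*} [Finite V] (G : SimpleGraph V) : ℤ[X] :=
  (existsUnique_chromaticPolynomial G).choose

theorem chromaticPolynomial_eval {V : Type*} [Finite V] (G : SimpleGraph V) (n : ℕ) :
    G.chromaticPolynomial.eval (n : ℤ) = Nat.card (G.Coloring (Fin n)) :=
  (existsUnique_chromaticPolynomial G).choose_spec.1 n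

end SimpleGraph

/-- The vertices of `X(k)`: the hub `none` of the `k`-spoke wheel, and for each rim vertex `i` the
six vertices of the copy of `K_{3,3}` replacing it. Here `some (i, .inl a)` are the three vertices
of the triangle obtained by truncating `i`, one for each edge-end of the wheel at `i`:
`a = 0` for the rim edge from the preceding rim vertex, `a = 1` for the spoke, and `a = 2` for the
rim edge to the following rim vertex; and `some (i, .inr b)` are the three vertices that subdivide
the edges of this triangle, each of which is also joined to the opposite vertex of the triangle. -/
abbrev XVertex (k : ℕ) : Type := Option (Fin k × (Fin 3 ⊕ Fin 3))

/-- The graph `X(k)`, obtained from the `k`-spoke wheel by replacing each rim vertex by a copy of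
`K_{3,3}`. For `k = 1` the rim of the wheel is a loop and for `k = 2` it is a double edge. -/
def XGraph (k : ℕ) : SimpleGraph (XVertex k) :=
  SimpleGraph.fromRel fun u v =>
    -- the edges inside the copies of `K_{3,3}`
    (∃ (i : Fin k) (a b : Fin 3), u = some (i, .inl a) ∧ v = some (i, .inr b)) ∨
    -- the spokes
    (∃ i : Fin k, u = none ∧ v = some (i, .inl 1)) ∨
    -- the rim edges, from `i` to `i + 1` modulo `k`
    (∃ i j : Fin k, (j : ℕ) = ((i : ℕ) + 1) % k ∧ u = some (i, .inl 2) ∧ v = some (j, .inl 0))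

/-! Fix the colour `h` of the hub. The gadgets then interact only through the rim edges, so
colourings are weighted closed walks: with `n` colours, the value of the chromatic polynomial of
`X(k)` is the sum over `h` of tr T^k. Here T is `gadgetMatrix h` times J - I, where J is the
all-ones matrix and J - I encodes a rim edge. T commutes with every permutation of the colours
fixing `h`. Such matrices act as a scalar on vectors that vanish at `h` and have sum zero, and as a
2×2 matrix on the span of the all-ones vector and the indicator of `h`. Hence T is annihilated by a
cubic with coefficients polynomial in `n` (`transferMatrix_pow_three`). Multiplying it by T^k and
taking traces gives the recurrence; agreement at all naturals makes it a polynomial identity. -/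

/-! ### Traces of matrix powers and closed walks -/

/-- The entries of a power of a matrix are sums over walks. -/
theorem Matrix.pow_succ_apply_eq_sum_walks {ι R : Type*} [Fintype ι] [DecidableEq ι]
    [CommSemiring R] (M : Matrix ι ι R) (k : ℕ) (a b : ι) :
    (M ^ (k + 1)) a b = ∑ x : Fin k → ι, ∏ i : Fin (k + 1),
      M (Fin.cons (α := fun _ => ι) a x i) (Fin.snoc (α := fun _ => ι) x b i) := by
  induction k generalizing a with
  | zero =>
    simp [Fin.snoc]
  | succ k ih =>
    rw [pow_succ', Matrix.mul_apply, ← (Fin.consEquiv fun _ : Fin (k + 1) => ι).sum_comp,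
      Fintype.sum_prod_type]
    refine Finset.sum_congr rfl fun c _ => ?_
    rw [ih, Finset.mul_sum]
    refine Finset.sum_congr rfl fun x _ => ?_
    rw [Fin.prod_univ_succ (n := k + 1)]
    simp only [Fin.consEquiv, Equiv.coe_fn_mk]
    rw [← Fin.cons_snoc_eq_snoc_cons]
    simp

/-- The trace of a power of a matrix is a sum over closed walks. -/
theorem Matrix.trace_pow_succ_eq_sum_closed_walks {ι R : Type*} [Fintype ι] [DecidableEq ι]
    [CommSemiring R] (M : Matrix ι ι R) (k : ℕ) :
    (M ^ (k + 1)).trace = ∑ y : Fin (k + 1) → ι, ∏ i, M (y i) (y (i + 1)) := by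
  rw [← (Fin.consEquiv fun _ : Fin (k + 1) => ι).sum_comp, Fintype.sum_prod_type, Matrix.trace]
  refine Finset.sum_congr rfl fun a _ => ?_
  rw [Matrix.diag_apply, Matrix.pow_succ_apply_eq_sum_walks]
  refine Finset.sum_congr rfl fun x _ => Finset.prod_congr rfl fun i _ => ?_
  -- For a closed walk the list of endpoints is the cyclic rotation of the list of starting points.
  rw [Fin.snoc_eq_cons_rotate]
  simp only [finRotate_apply]
  rfl

/-- This shrinks the state space from colourings of a whole gadget to single colours. -/
theorem Matrix.trace_mul_pow_succ {ι κ R : Type*} [Fintype ι] [DecidableEq ι] [Fintype κ]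
    [DecidableEq κ] [CommSemiring R] (U : Matrix ι κ R) (V : Matrix κ ι R) (k : ℕ) :
    ((U * V) ^ (k + 1)).trace = ((V * U) ^ (k + 1)).trace := by
  have h : ∀ k : ℕ, (U * V) ^ (k + 1) = U * (V * U) ^ k * V := by
    intro k
    induction k with
    | zero => simp
    | succ k ih =>
      rw [pow_succ, ih, pow_succ]
      simp only [Matrix.mul_assoc]
  rw [h, Matrix.trace_mul_comm, ← Matrix.mul_assoc, ← pow_succ']

/-! ### The algebra of matrices invariant under permutations fixing the hub colour -/

/-- The matrices indexed by the colours that are invariant under all permutations of the colours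
fixing the colour `h` of the hub, in terms of a basis of the algebra they form. -/
def hubMatrix {n : ℕ} (h : Fin n) (a b c d e : ℤ) : Matrix (Fin n) (Fin n) ℤ :=
  Matrix.of fun x z => a + (if x = z then b else 0) + (if x = h then c else 0) +
    (if z = h then d else 0) + (if x = h then if z = h then e else 0 else 0)

theorem hubMatrix_mul {n : ℕ} (h : Fin n) (a b c d e a' b' c' d' e' : ℤ) :
    hubMatrix h a b c d e * hubMatrix h a' b' c' d' e' =
      hubMatrix h (n * a * a' + a * b' + a * c' + b * a' + d * a' + d * c')
        (b * b')
        (n * c * a' + c * b' + c * c' + b * c' + e * a' + e * c')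
        (n * a * d' + a * e' + b * d' + d * b' + d * d' + d * e')
        (n * c * d' + c * e' + b * e' + e * b' + e * d' + e * e') := by
  ext x z
  simp only [Matrix.mul_apply, hubMatrix, Matrix.of_apply, mul_add, add_mul,
    Finset.sum_add_distrib, mul_ite, ite_mul, mul_zero, zero_mul, Finset.sum_ite_eq,
    Finset.sum_ite_eq', Finset.mem_univ, if_true, Finset.sum_const, Finset.card_univ,
    Fintype.card_fin, nsmul_eq_mul]
  by_cases hx : x = h <;> by_cases hz : z = h
  · subst hx; subst hz; simp [Finset.sum_add_distrib]; ring
  · subst hx; simp [hz, Ne.symm hz]; ring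
  · subst hz; simp [hx, Finset.sum_add_distrib]; ring
  · by_cases hxz : x = z
    · subst hxz; simp [hx]; ring
    · simp [hx, hz, hxz]; ring

theorem hubMatrix_add {n : ℕ} (h : Fin n) (a b c d e a' b' c' d' e' : ℤ) :
    hubMatrix h a b c d e + hubMatrix h a' b' c' d' e' =
      hubMatrix h (a + a') (b + b') (c + c') (d + d') (e + e') := by
  ext x z
  simp only [Matrix.add_apply, hubMatrix, Matrix.of_apply]
  split_ifs <;> ring

theorem smul_hubMatrix {n : ℕ} (h : Fin n) (r a b c d e : ℤ) :
    r • hubMatrix h a b c d e = hubMatrix h (r * a) (r * b) (r * c) (r * d) (r * e) := by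
  ext x z
  simp only [Matrix.smul_apply, hubMatrix, Matrix.of_apply, smul_eq_mul]
  split_ifs <;> ring

theorem trace_hubMatrix {n : ℕ} (h : Fin n) (a b c d e : ℤ) :
    (hubMatrix h a b c d e).trace = n * (a + b) + c + d + e := by
  simp [Matrix.trace, hubMatrix, Finset.sum_add_distrib]

/-! ### From colourings to the transfer matrix -/

/-- The proper colourings of `K_{3,3}` such that the second vertex of the first class does not
have the colour `h`. -/
def GadgetColoring {n : ℕ} (h : Fin n) (s : Fin 3 ⊕ Fin 3 → Fin n) : Prop :=
  (∀ a b, s (.inl a) ≠ s (.inr b)) ∧ h ≠ s (.inl 1)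

open Classical in
theorem card_coloring_XGraph (k n : ℕ) :
    (Nat.card ((XGraph (k + 1)).Coloring (Fin n)) : ℤ) =
      ∑ h : Fin n, ∑ f : Fin (k + 1) → Fin 3 ⊕ Fin 3 → Fin n, ∏ i,
        if GadgetColoring h (f i) ∧ f i (.inl 2) ≠ f (i + 1) (.inl 0) then (1 : ℤ) else 0 := by
  let Q : Fin n × (Fin (k + 1) → Fin 3 ⊕ Fin 3 → Fin n) → Prop := fun p =>
    ∀ i, GadgetColoring p.1 (p.2 i) ∧ p.2 i (.inl 2) ≠ p.2 (i + 1) (.inl 0)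
  have hsucc : ∀ i j : Fin (k + 1), (j : ℕ) = ((i : ℕ) + 1) % (k + 1) ↔ j = i + 1 := by
    intro i j
    rw [Fin.ext_iff, Fin.val_add]
    simp
  have hcard : Nat.card ((XGraph (k + 1)).Coloring (Fin n)) = Nat.card {p // Q p} := by
    refine Nat.card_congr
      { toFun := fun c => ⟨(c none, fun i s => c (some (i, s))), fun i => ⟨⟨fun a b => ?_, ?_⟩, ?_⟩⟩
        invFun := fun p => SimpleGraph.Coloring.mk
          (fun v => v.elim p.1.1 fun w => p.1.2 w.1 w.2) ?_
        left_inv := ?_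
        right_inv := fun p => rfl }
    · refine c.valid ⟨by simp, Or.inl (Or.inl ⟨i, a, b, rfl, rfl⟩)⟩
    · refine c.valid ⟨by simp, Or.inl (Or.inr (Or.inl ⟨i, rfl, rfl⟩))⟩
    · refine c.valid ⟨by simp, Or.inl (Or.inr (Or.inr ⟨i, i + 1, (hsucc _ _).2 rfl, rfl, rfl⟩))⟩
    · have key : ∀ u v : XVertex (k + 1),
          ((∃ (i : Fin (k + 1)) (a b : Fin 3), u = some (i, .inl a) ∧ v = some (i, .inr b)) ∨
          (∃ i : Fin (k + 1), u = none ∧ v = some (i, .inl 1)) ∨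
          (∃ i j : Fin (k + 1), (j : ℕ) = ((i : ℕ) + 1) % (k + 1) ∧ u = some (i, .inl 2) ∧
            v = some (j, .inl 0))) →
          u.elim p.1.1 (fun w => p.1.2 w.1 w.2) ≠ v.elim p.1.1 (fun w => p.1.2 w.1 w.2) := by
        rintro u v (⟨i, a, b, rfl, rfl⟩ | ⟨i, rfl, rfl⟩ | ⟨i, j, hij, rfl, rfl⟩)
        · exact (p.2 i).1.1 a b
        · exact (p.2 i).1.2
        · rw [hsucc] at hij
          subst hij
          exact (p.2 i).2
      rintro u v ⟨-, h | h⟩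
      · exact key u v h
      · exact (key v u h).symm
    · intro c
      ext v
      rcases v with _ | ⟨i, s⟩ <;> rfl
  rw [hcard, Nat.card_eq_fintype_card, Fintype.card_subtype, ← Finset.sum_boole,
    Fintype.sum_prod_type]
  refine Finset.sum_congr rfl fun h _ => Finset.sum_congr rfl fun f _ => ?_
  rw [Finset.prod_boole]
  simp [Q]

/-- The number of colours different from three given colours. -/
def freeColors {n : ℕ} (x y z : Fin n) : ℤ :=
  ∑ c : Fin n, if x ≠ c ∧ y ≠ c ∧ z ≠ c then 1 else 0

/-- The number of colourings of a gadget in which the two rim corners have given colours and the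
spoke corner is not coloured with the colour `h` of the hub. -/
def gadgetMatrix {n : ℕ} (h : Fin n) : Matrix (Fin n) (Fin n) ℤ :=
  Matrix.of fun x z => ∑ y, if y = h then 0 else freeColors x y z ^ 3

theorem freeColors_eq {n : ℕ} (x y z : Fin n) :
    freeColors x y z = n - ({x, y, z} : Finset (Fin n)).card := by
  have : (Finset.univ.filter fun c : Fin n => x ≠ c ∧ y ≠ c ∧ z ≠ c) = {x, y, z}ᶜ := by
    ext c
    simp [eq_comm]
  rw [freeColors, Finset.sum_boole, this, Finset.card_compl, Fintype.card_fin,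
    Nat.cast_sub (by simpa using Finset.card_le_univ ({x, y, z} : Finset (Fin n)))]

/-- Once one class of `K_{3,3}` is coloured, the three vertices of the other class choose
independently among the free colours, whence the cube. -/
theorem sum_gadget_colorings {n : ℕ} (F : Fin n → Fin n → Fin n → ℤ) :
    (∑ s : Fin 3 ⊕ Fin 3 → Fin n, (if ∀ a b, s (.inl a) ≠ s (.inr b) then 1 else 0) *
      F (s (.inl 0)) (s (.inl 1)) (s (.inl 2))) =
    ∑ x, ∑ y, ∑ z, freeColors x y z ^ 3 * F x y z := by
  rw [← (Equiv.sumArrowEquivProdArrow (Fin 3) (Fin 3) (Fin n)).symm.sum_comp,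
    Fintype.sum_prod_type]
  have hb : ∀ u : Fin 3 → Fin n,
      (∑ v : Fin 3 → Fin n, (if ∀ a b, u a ≠ v b then (1 : ℤ) else 0)) =
        freeColors (u 0) (u 1) (u 2) ^ 3 := by
    intro u
    have := Finset.prod_univ_sum (fun _ : Fin 3 => (Finset.univ : Finset (Fin n)))
      fun _ c => if u 0 ≠ c ∧ u 1 ≠ c ∧ u 2 ≠ c then (1 : ℤ) else 0
    rw [Finset.prod_const, Finset.card_univ, Fintype.card_fin, Fintype.piFinset_univ] at this
    rw [freeColors, this]
    refine Finset.sum_congr rfl fun v _ => ?_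
    rw [Finset.prod_boole]
    congr 1
    simp only [Fin.forall_fin_succ, eq_iff_iff]
    simp
    tauto
  trans ∑ u : Fin 3 → Fin n, freeColors (u 0) (u 1) (u 2) ^ 3 * F (u 0) (u 1) (u 2)
  · refine Finset.sum_congr rfl fun u _ => ?_
    rw [← hb, Finset.sum_mul]
    rfl
  rw [← (Fin.consEquiv fun _ : Fin 3 => Fin n).sum_comp, Fintype.sum_prod_type]
  refine Finset.sum_congr rfl fun x _ => ?_
  rw [← (Fin.consEquiv fun _ : Fin 2 => Fin n).sum_comp, Fintype.sum_prod_type]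
  refine Finset.sum_congr rfl fun y _ => ?_
  rw [← (Equiv.funUnique (Fin 1) (Fin n)).symm.sum_comp]
  rfl

-- Compatibility of consecutive gadgets depends on the next one only through its left corner. The
-- walk matrix on gadget colourings thus factors as `U * V` through single colours, and `V * U` is
-- the transfer matrix.
open Classical in
theorem sum_closed_walks_eq_trace {n : ℕ} (h : Fin n) (k : ℕ) :
    (∑ f : Fin (k + 1) → Fin 3 ⊕ Fin 3 → Fin n, ∏ i,
      if GadgetColoring h (f i) ∧ f i (.inl 2) ≠ f (i + 1) (.inl 0) then (1 : ℤ) else 0) =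
      ((gadgetMatrix h * hubMatrix h 1 (-1) 0 0 0) ^ (k + 1)).trace := by
  let U : Matrix (Fin 3 ⊕ Fin 3 → Fin n) (Fin n) ℤ :=
    Matrix.of fun s x => if GadgetColoring h s ∧ s (.inl 2) ≠ x then 1 else 0
  let V : Matrix (Fin n) (Fin 3 ⊕ Fin 3 → Fin n) ℤ :=
    Matrix.of fun x s => if s (.inl 0) = x then 1 else 0
  have hVU : V * U = gadgetMatrix h * hubMatrix h 1 (-1) 0 0 0 := by
    ext x w
    have hs := sum_gadget_colorings fun x' y z =>
      if x' = x then if y = h then 0 else if z = w then 0 else 1 else 0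
    trans ∑ x', ∑ y, ∑ z, freeColors x' y z ^ 3 *
      if x' = x then if y = h then 0 else if z = w then 0 else 1 else 0
    · rw [Matrix.mul_apply, ← hs]
      refine Finset.sum_congr rfl fun s _ => ?_
      simp only [U, V, Matrix.of_apply, GadgetColoring]
      by_cases h1 : s (.inl 0) = x <;> by_cases h2 : s (.inl 1) = h <;>
        by_cases h3 : s (.inl 2) = w <;> simp [h1, h2, h3, Ne.symm]
    · rw [Finset.sum_eq_single x (by intros; simp [*]) (by simp), Finset.sum_comm,
        Matrix.mul_apply]
      simp only [gadgetMatrix, hubMatrix, Matrix.of_apply]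
      refine Finset.sum_congr rfl fun z _ => ?_
      by_cases h3 : z = w <;> simp [h3]
  rw [← hVU, ← Matrix.trace_mul_pow_succ, Matrix.trace_pow_succ_eq_sum_closed_walks]
  refine Finset.sum_congr rfl fun f _ => Finset.prod_congr rfl fun i _ => ?_
  simp [U, V, Matrix.mul_apply]

/-- An entry depends only on which of `x`, `z`, `h` coincide. The parameters come from the generic
entry by successive differences: diagonal, row `h`, column `h`, then the corner. -/
theorem gadgetMatrix_eq {n : ℕ} (h : Fin n) :
    gadgetMatrix h = hubMatrix h (2 * ((n : ℤ) - 2) ^ 3 + (n - 3) * (n - 3) ^ 3)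
      (((n : ℤ) - 1) ^ 3 + (n - 2) * (n - 2) ^ 3 -
        (2 * ((n : ℤ) - 2) ^ 3 + (n - 3) * (n - 3) ^ 3))
      (((n : ℤ) - 2) ^ 3 + (n - 2) * (n - 3) ^ 3 -
        (2 * ((n : ℤ) - 2) ^ 3 + (n - 3) * (n - 3) ^ 3))
      (((n : ℤ) - 2) ^ 3 + (n - 2) * (n - 3) ^ 3 -
        (2 * ((n : ℤ) - 2) ^ 3 + (n - 3) * (n - 3) ^ 3))
      (((n : ℤ) - 1) * (n - 2) ^ 3 - (((n : ℤ) - 1) ^ 3 + (n - 2) * (n - 2) ^ 3) -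
        2 * (((n : ℤ) - 2) ^ 3 + (n - 2) * (n - 3) ^ 3 -
        (2 * ((n : ℤ) - 2) ^ 3 + (n - 3) * (n - 3) ^ 3))) := by
  -- `p` is the term of a generic spoke colour `y`; `q`, `r`, `s` correct it at `h` and at the rim
  -- colours.
  have hsum : ∀ (u v : Fin n) (p q r s : ℤ),
      (∑ y : Fin n, (p + (if y = h then q else 0) + (if y = u then r else 0) +
        (if y = v then s else 0))) = n * p + q + r + s := by
    intro u v p q r s
    simp [Finset.sum_add_distrib]
  ext x z
  simp only [gadgetMatrix, Matrix.of_apply, freeColors_eq, hubMatrix]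
  by_cases hx : x = h <;> by_cases hz : z = h
  · subst hx; subst hz
    have := hsum z z (((n : ℤ) - 2) ^ 3) (-((n : ℤ) - 2) ^ 3) 0 0
    refine (Finset.sum_congr rfl fun y _ => ?_).trans (this.trans ?_)
    · by_cases hy : y = z
      · simp [hy]
      · simp [hy]
    · simp; ring
  · subst hx
    have := hsum z x (((n : ℤ) - 3) ^ 3) (-((n : ℤ) - 3) ^ 3)
      (((n : ℤ) - 2) ^ 3 - ((n : ℤ) - 3) ^ 3) 0
    refine (Finset.sum_congr rfl fun y _ => ?_).trans (this.trans ?_)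
    · by_cases hy : y = x
      · simp [hy, Ne.symm hz]
      · by_cases hyz : y = z
        · simp [hyz, hz, Ne.symm hz]
        · simp [hy, hyz, Finset.card_eq_three.2 ⟨x, y, z, Ne.symm hy, Ne.symm hz, hyz, rfl⟩]
    · simp [hz, Ne.symm hz]; ring
  · subst hz
    have := hsum x z (((n : ℤ) - 3) ^ 3) (-((n : ℤ) - 3) ^ 3)
      (((n : ℤ) - 2) ^ 3 - ((n : ℤ) - 3) ^ 3) 0
    refine (Finset.sum_congr rfl fun y _ => ?_).trans (this.trans ?_)
    · by_cases hy : y = z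
      · simp [hy, Ne.symm hx]
      · by_cases hyx : y = x
        · simp [hyx, hx]
        · simp [hy, hyx, Finset.card_eq_three.2 ⟨x, y, z, Ne.symm hyx, hx, hy, rfl⟩]
    · simp [hx]; ring
  · by_cases hxz : x = z
    · subst hxz
      have := hsum x x (((n : ℤ) - 2) ^ 3) (-((n : ℤ) - 2) ^ 3)
        (((n : ℤ) - 1) ^ 3 - ((n : ℤ) - 2) ^ 3) 0
      refine (Finset.sum_congr rfl fun y _ => ?_).trans (this.trans ?_)
      · by_cases hy : y = h
        · simp [hy, Ne.symm hx]
        · by_cases hyx : y = x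
          · simp [hyx, hx]
          · simp [hy, hyx, Ne.symm hyx]
      · simp [hx]; ring
    · have := hsum x z (((n : ℤ) - 3) ^ 3) (-((n : ℤ) - 3) ^ 3)
        (((n : ℤ) - 2) ^ 3 - ((n : ℤ) - 3) ^ 3) (((n : ℤ) - 2) ^ 3 - ((n : ℤ) - 3) ^ 3)
      refine (Finset.sum_congr rfl fun y _ => ?_).trans (this.trans ?_)
      · by_cases hy : y = h
        · simp [hy, Ne.symm hx, Ne.symm hz]
        · by_cases hyx : y = x
          · simp [hyx, hx, hxz]
          · by_cases hyz : y = z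
            · simp [hyz, hz, hxz, Ne.symm hxz]
            · simp [hy, hyx, hyz,
                Finset.card_eq_three.2 ⟨x, y, z, Ne.symm hyx, hxz, hyz, rfl⟩]
      · simp [hx, hz, hxz]; ring

theorem one_eq_hubMatrix {n : ℕ} (h : Fin n) : 1 = hubMatrix h 0 1 0 0 0 := by
  ext x z
  simp [hubMatrix, Matrix.one_apply]

/-- The transfer matrix of a gadget followed by a rim edge. -/
def transferMatrix {n : ℕ} (h : Fin n) : Matrix (Fin n) (Fin n) ℤ :=
  gadgetMatrix h * hubMatrix h 1 (-1) 0 0 0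

/-- The scalar eigenvalue is -(n - 2)(3n² - 15n + 25), which explains that factor of the constant
term; the remaining quadratic is the characteristic polynomial of the 2×2 block. -/
theorem transferMatrix_pow_three {n : ℕ} (h : Fin n) :
    transferMatrix h ^ 3 =
      (((n : ℤ) ^ 5 - 9 * n ^ 4 + 37 * n ^ 3 - 88 * n ^ 2 + 127 * n - 94) * (n - 2)) •
        transferMatrix h ^ 2 +
      ((6 * (n : ℤ) ^ 7 - 81 * n ^ 6 + 497 * n ^ 5 - 1781 * n ^ 4 + 4026 * n ^ 3 - 5780 * n ^ 2
        + 4968 * n - 2024) * (n - 2) ^ 2) • transferMatrix h +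
      ((((n : ℤ) - 1) ^ 2 * (3 * n ^ 2 - 15 * n + 25) *
        (3 * n ^ 5 - 33 * n ^ 4 + 157 * n ^ 3 - 399 * n ^ 2 + 535 * n - 299)) * (n - 2) ^ 3) •
        1 := by
  rw [pow_succ, pow_two, transferMatrix, one_eq_hubMatrix h, gadgetMatrix_eq]
  simp only [hubMatrix_mul, smul_hubMatrix, hubMatrix_add]
  -- Compare the five parameters of both sides: each is a polynomial identity in `n`.
  congr 1 <;> ring

/-! ### The chromatic polynomials -/

theorem eval_chromaticPolynomial_XGraph (k n : ℕ) :
    (XGraph (k + 1)).chromaticPolynomial.eval (n : ℤ) =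
      ∑ h : Fin n, (transferMatrix h ^ (k + 1)).trace := by
  rw [SimpleGraph.chromaticPolynomial_eval, card_coloring_XGraph]
  exact Finset.sum_congr rfl fun h _ => sum_closed_walks_eq_trace h k

theorem Polynomial.eq_of_forall_eval_natCast_eq {P Q : ℤ[X]}
    (h : ∀ n : ℕ, P.eval (n : ℤ) = Q.eval (n : ℤ)) : P = Q := by
  refine Polynomial.eq_of_infinite_eval_eq P Q
    ((Set.infinite_range_of_injective (Nat.cast_injective (R := ℤ))).mono ?_)
  rintro _ ⟨n, rfl⟩
  exact h n

theorem eval_chromaticPolynomial_XGraph_of_trace (k n : ℕ) (r : ℤ)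
    (h : ∀ h : Fin n, (transferMatrix h ^ (k + 1)).trace = r) :
    (XGraph (k + 1)).chromaticPolynomial.eval (n : ℤ) = n * r := by
  rw [eval_chromaticPolynomial_XGraph, Finset.sum_congr rfl fun x _ => h x]
  simp

theorem chromaticPolynomial_XGraph_one : (XGraph 1).chromaticPolynomial =
    X * (X - 1) ^ 2 * (X - 2) * (X ^ 3 - 7 * X ^ 2 + 19 * X - 19) := by
  refine Polynomial.eq_of_forall_eval_natCast_eq fun n => ?_
  rw [eval_chromaticPolynomial_XGraph_of_trace 0 n
    (((n : ℤ) - 1) ^ 2 * (n - 2) * (n ^ 3 - 7 * n ^ 2 + 19 * n - 19)) fun h => ?_]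
  · simp
    ring
  · rw [zero_add, pow_one, transferMatrix, gadgetMatrix_eq, hubMatrix_mul, trace_hubMatrix]
    ring

theorem chromaticPolynomial_XGraph_two : (XGraph 2).chromaticPolynomial =
    X * (X - 1) * (X - 2) ^ 2 *
      (X ^ 9 - 17 * X ^ 8 + 138 * X ^ 7 - 692 * X ^ 6 + 2353 * X ^ 5 - 5630 * X ^ 4
        + 9525 * X ^ 3 - 11086 * X ^ 2 + 8152 * X - 2913) := by
  refine Polynomial.eq_of_forall_eval_natCast_eq fun n => ?_
  rw [eval_chromaticPolynomial_XGraph_of_trace 1 n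
    (((n : ℤ) - 1) * (n - 2) ^ 2 *
      (n ^ 9 - 17 * n ^ 8 + 138 * n ^ 7 - 692 * n ^ 6 + 2353 * n ^ 5 - 5630 * n ^ 4
        + 9525 * n ^ 3 - 11086 * n ^ 2 + 8152 * n - 2913)) fun h => ?_]
  · simp
    ring
  · rw [one_add_one_eq_two, pow_two, transferMatrix, gadgetMatrix_eq, hubMatrix_mul,
      hubMatrix_mul, trace_hubMatrix]
    ring

theorem chromaticPolynomial_XGraph_three : (XGraph 3).chromaticPolynomial =
    X * (X - 1) * (X - 2) ^ 3 *
      (X ^ 14 - 26 * X ^ 13 + 328 * X ^ 12 - 2645 * X ^ 11 + 15181 * X ^ 10 - 65498 * X ^ 9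
        + 219032 * X ^ 8 - 577468 * X ^ 7 + 1209533 * X ^ 6 - 2011958 * X ^ 5
        + 2633017 * X ^ 4 - 2650178 * X ^ 3 + 1957169 * X ^ 2 - 957460 * X + 235366) := by
  refine Polynomial.eq_of_forall_eval_natCast_eq fun n => ?_
  rw [eval_chromaticPolynomial_XGraph_of_trace 2 n
    (((n : ℤ) - 1) * (n - 2) ^ 3 *
      (n ^ 14 - 26 * n ^ 13 + 328 * n ^ 12 - 2645 * n ^ 11 + 15181 * n ^ 10 - 65498 * n ^ 9
        + 219032 * n ^ 8 - 577468 * n ^ 7 + 1209533 * n ^ 6 - 2011958 * n ^ 5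
        + 2633017 * n ^ 4 - 2650178 * n ^ 3 + 1957169 * n ^ 2 - 957460 * n + 235366)) fun h => ?_]
  · simp
    ring
  · rw [pow_succ, pow_two, transferMatrix, gadgetMatrix_eq, hubMatrix_mul,
      hubMatrix_mul, hubMatrix_mul, trace_hubMatrix]
    ring

theorem chromaticPolynomial_XGraph_add_three (k : ℕ) (hk : 1 ≤ k) :
    (XGraph (k + 3)).chromaticPolynomial =
      (X ^ 5 - 9 * X ^ 4 + 37 * X ^ 3 - 88 * X ^ 2 + 127 * X - 94) *
          (X - 2) * (XGraph (k + 2)).chromaticPolynomial +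
      (6 * X ^ 7 - 81 * X ^ 6 + 497 * X ^ 5 - 1781 * X ^ 4 + 4026 * X ^ 3 - 5780 * X ^ 2
            + 4968 * X - 2024) *
          (X - 2) ^ 2 * (XGraph (k + 1)).chromaticPolynomial +
      ((X - 1) ^ 2 * (3 * X ^ 2 - 15 * X + 25) *
            (3 * X ^ 5 - 33 * X ^ 4 + 157 * X ^ 3 - 399 * X ^ 2 + 535 * X - 299)) *
          (X - 2) ^ 3 * (XGraph k).chromaticPolynomial := by
  -- The trace formula needs a positive exponent: at exponent 0 it would give n², while the lone hub
  -- has n colourings.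
  obtain ⟨k, rfl⟩ := Nat.exists_eq_add_of_le' hk
  refine Polynomial.eq_of_forall_eval_natCast_eq fun n => ?_
  simp only [eval_add, eval_sub, eval_mul, eval_pow, eval_X, eval_ofNat, eval_one,
    show k + 1 + 3 = k + 3 + 1 from rfl, show k + 1 + 2 = k + 2 + 1 from rfl,
    eval_chromaticPolynomial_XGraph, Finset.mul_sum, ← Finset.sum_add_distrib]
  refine Finset.sum_congr rfl fun h _ => ?_
  rw [show k + 3 + 1 = k + 1 + 3 from rfl, pow_add, transferMatrix_pow_three]
  simp only [mul_add, Matrix.mul_smul, Matrix.trace_add, Matrix.trace_smul, smul_eq_mul, mul_one,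
    ← pow_add, ← pow_succ]

theorem mainTheorem2 :
    (∀ k : ℕ, 1 ≤ k →
      (XGraph (k + 3)).chromaticPolynomial =
        (X ^ 5 - 9 * X ^ 4 + 37 * X ^ 3 - 88 * X ^ 2 + 127 * X - 94) *
            (X - 2) * (XGraph (k + 2)).chromaticPolynomial +
        (6 * X ^ 7 - 81 * X ^ 6 + 497 * X ^ 5 - 1781 * X ^ 4 + 4026 * X ^ 3 - 5780 * X ^ 2
              + 4968 * X - 2024) *
            (X - 2) ^ 2 * (XGraph (k + 1)).chromaticPolynomial +
        ((X - 1) ^ 2 * (3 * X ^ 2 - 15 * X + 25) *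
              (3 * X ^ 5 - 33 * X ^ 4 + 157 * X ^ 3 - 399 * X ^ 2 + 535 * X - 299)) *
            (X - 2) ^ 3 * (XGraph k).chromaticPolynomial) ∧
    (XGraph 1).chromaticPolynomial =
      X * (X - 1) ^ 2 * (X - 2) * (X ^ 3 - 7 * X ^ 2 + 19 * X - 19) ∧
    (XGraph 2).chromaticPolynomial =
      X * (X - 1) * (X - 2) ^ 2 *
        (X ^ 9 - 17 * X ^ 8 + 138 * X ^ 7 - 692 * X ^ 6 + 2353 * X ^ 5 - 5630 * X ^ 4
          + 9525 * X ^ 3 - 11086 * X ^ 2 + 8152 * X - 2913) ∧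
    (XGraph 3).chromaticPolynomial =
      X * (X - 1) * (X - 2) ^ 3 *
        (X ^ 14 - 26 * X ^ 13 + 328 * X ^ 12 - 2645 * X ^ 11 + 15181 * X ^ 10 - 65498 * X ^ 9
          + 219032 * X ^ 8 - 577468 * X ^ 7 + 1209533 * X ^ 6 - 2011958 * X ^ 5
          + 2633017 * X ^ 4 - 2650178 * X ^ 3 + 1957169 * X ^ 2 - 957460 * X + 235366) := by
  exact ⟨chromaticPolynomial_XGraph_add_three, chromaticPolynomial_XGraph_one,
    chromaticPolynomial_XGraph_two, chromaticPolynomial_XGraph_three⟩
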